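/- Let $\mathbf H$ be the skew field of real quaternions. For $A=(a_{ij})\in M(n,\mathbf H)$ and $1\le i\le n$, the $i$-th row determinant is $$\operatorname{rdet}_i A=\sum_{\sigma\in S_n}(-1)^{n-r}\,a_{i\,\sigma(i)}a_{\sigma(i)\,\sigma^2(i)}\cdots a_{\sigma^{-1}(i)\,i}\;\prod_{t=2}^{r}\bigl(a_{m_t\,\sigma(m_t)}a_{\sigma(m_t)\,\sigma^2(m_t)}\cdots a_{\sigma^{-1}(m_t)\,m_t}\bigr),$$ where $r$ is the number of cycles of $\sigma$ (fixed points included), $m_2<\dots<m_r$ are the smallest elements of the cycles of $\sigma$ that do not contain $i$, and the factors are taken from left to right in the order written. The $j$-th column determinant $\operatorname{cdet}_j A$ is given by the same sum with $i=j$ and with the blocks belonging to the cycles arranged from right to left: the block starting at $j$ is the rightmost, and the blocks starting at $m_2,\dots,m_r$ follow successively to its left (the order inside each block is unchanged). Theorem (Cramer rule for a Hermitian left system). Let $A\in M(n,\mathbf H)$ be Hermitian. Then $\operatorname{rdet}_1A=\dots=\operatorname{rdet}_nA=\operatorname{cdet}_1A=\dots=\operatorname{cdet}_nA\in\mathbb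 R$; denote this common value by $\det A$. If $\det A\neq 0$, then for every row $y=(y_1,\dots,y_n)\in\mathbf H^{1\times n}$ the left system $xA=y$ has exactly one solution $x=(x_1,\dots,x_n)\in\mathbf H^{1\times n}$, and it is given by $$x_i=\frac{\operatorname{rdet}_i A_{i.}(y)}{\det A},\qquad i=1,\dots,n,$$ where $A_{i.}(y)$ is the matrix obtained from $A$ by replacing its $i$-th row by $y$. -/

import Mathlib

namespace RowColumnDet

/-- The product of the entries of `A` along the cycle of `σ` through `m`, read from `m` on:
`A m (σ m) * A (σ m) (σ (σ m)) * ⋯ * A (σ⁻¹ m) m`. A fixed point `m` contributes `A m m`. -/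
noncomputable def cycleProd {R : Type*} [Ring R] {n : ℕ} (A : Matrix (Fin n) (Fin n) R)
    (σ : Equiv.Perm (Fin n)) (m : Fin n) : R :=
  ((List.iterate σ m (Function.minimalPeriod σ m)).map fun k => A k (σ k)).prod

/-- The opening elements of the cycles of `σ` (cycles of length one included), in order: first `i`
for its own cycle, then the smallest elements of all the other cycles in increasing order. -/
def cycleStarts {n : ℕ} (σ : Equiv.Perm (Fin n)) (i : Fin n) : List (Fin n) :=
  i :: (List.finRange n).filter fun m => ¬ σ.SameCycle i m ∧ ∀ k, σ.SameCycle m k → m ≤ k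

/-- The `i`-th row determinant: in each monomial the cycle through `i` comes first, from the left,
followed by the other cycles ordered by increasing smallest elements, each read from its smallest
element on. -/
noncomputable def rdet {R : Type*} [Ring R] {n : ℕ} (i : Fin n) (A : Matrix (Fin n) (Fin n) R) :
    R :=
  ∑ σ : Equiv.Perm (Fin n),
    Equiv.Perm.sign σ • ((cycleStarts σ i).map (cycleProd A σ)).prod

/-- The `j`-th column determinant: in each monomial the cycles are arranged from right to left.
The right-ordered notation `(τ j, τ (τ j), …, τ⁻¹ j, j)` of the cycle through `j` stands for the
factors `A j (τ j) * A (τ j) (τ (τ j)) * ⋯ * A (τ⁻¹ j) j` in this order; this block is the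
rightmost one, and the other cycles follow to its left by increasing smallest elements. -/
noncomputable def cdet {R : Type*} [Ring R] {n : ℕ} (j : Fin n) (A : Matrix (Fin n) (Fin n) R) :
    R :=
  ∑ τ : Equiv.Perm (Fin n),
    Equiv.Perm.sign τ • ((cycleStarts τ j).reverse.map (cycleProd A τ)).prod

/-- The determinant of a Hermitian quaternion matrix, given as its first row determinant
(`1` if `n = 0`). For a Hermitian matrix all row and column determinants agree; no such agreement
is built into this definition. -/
noncomputable def hermDet : {n : ℕ} → Matrix (Fin n) (Fin n) (Quaternion ℝ) → Quaternion ℝ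
  | 0, _ => 1
  | _ + 1, A => rdet 0 A

end RowColumnDet

/-!
Let `A` be Hermitian. Reading a cycle of a permutation `σ` backwards (`flipCycle`) preserves the
sign of `σ` and all other cycles and, as long as the cycle only meets Hermitian entries, conjugates
the product of the entries along it (`cycleProd_inv`). Averaging over these flips replaces each
cycle product in a row determinant by its real part (`rdet_eq_sum_partialRe`). Real parts commute
with everything, and by `Re (a * b) = Re (b * a)` they do not depend on the element at which a
cycle is opened, so every `rdet i A` equals the same real number `reDet A`. Conjugating `rdet j A`
term by term gives `cdet j A`, hence the column determinants have this value as well.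

For the Cramer rule, `rdet i` of `A.updateRow i y` is linear in `y`, with coefficients that multiply
from the right (`exists_cofactors`). It remains to see that the value is `0` if `y` is another row
`A k` (`rdet_eq_zero_of_row_eq`). The map `σ ↦ σ * swap i k` matches the permutations in which `i`
and `k` lie in different cycles with those in which they share one, and changes the sign. As the
rows `i` and `k` agree, the merged cycle contributes the product of the two separate ones
(`cycleProd_mul_swap`), and the flip of the cycle through `k` alone again replaces its product by
the real part, so that the two families of summands cancel. Thus the matrix of cofactors is a right
inverse of `A` up to the factor `reDet A`. Taking conjugate transposes, it is also a left inverse.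
-/

namespace RowColumnDet

open Equiv.Perm Function

variable {n : ℕ}

/-! ### Orbits and products along cycles -/

section CycleProd

variable {σ τ : Equiv.Perm (Fin n)} {m : Fin n}

lemma sameCycle_iterate (σ : Equiv.Perm (Fin n)) (m : Fin n) (t : ℕ) :
    σ.SameCycle m (σ^[t] m) := by
  rw [iterate_eq_pow]
  exact sameCycle_pow_right.2 (SameCycle.refl _ _)

lemma exists_iterate_eq {x : Fin n} (h : σ.SameCycle m x) : ∃ t : ℕ, σ^[t] m = x := by
  obtain ⟨t, ht⟩ := h.exists_nat_pow_eq
  exact ⟨t, by rw [iterate_eq_pow, ht]⟩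

lemma mem_periodicPts (σ : Equiv.Perm (Fin n)) (m : Fin n) : m ∈ periodicPts σ :=
  σ.injective.mem_periodicPts m

lemma iterate_congr (h : ∀ x, σ.SameCycle m x → τ x = σ x) (t : ℕ) : τ^[t] m = σ^[t] m := by
  induction t with
  | zero => rfl
  | succ t ih => rw [iterate_succ_apply', iterate_succ_apply', ih, h _ (sameCycle_iterate σ m t)]

lemma sameCycle_congr (h : ∀ x, σ.SameCycle m x → τ x = σ x) (x : Fin n) :
    τ.SameCycle m x ↔ σ.SameCycle m x := by
  constructor
  · intro hx
    obtain ⟨t, rfl⟩ := exists_iterate_eq hx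
    rw [iterate_congr h]
    exact sameCycle_iterate σ m t
  · intro hx
    obtain ⟨t, rfl⟩ := exists_iterate_eq hx
    rw [← iterate_congr h]
    exact sameCycle_iterate τ m t

variable {R : Type*} [Ring R] {A B : Matrix (Fin n) (Fin n) R}

lemma cycleProd_eq_prod_range (A : Matrix (Fin n) (Fin n) R) (σ : Equiv.Perm (Fin n))
    (m : Fin n) :
    cycleProd A σ m =
      ((List.range (minimalPeriod σ m)).map fun t => A (σ^[t] m) (σ^[t + 1] m)).prod := by
  simp only [cycleProd, ← List.range_map_iterate, List.map_map, comp_def, iterate_succ_apply']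

/-- The product along the cycle through `m` only sees the permutation and the matrix entries on
that cycle. -/
lemma cycleProd_congr (h : ∀ x, σ.SameCycle m x → τ x = σ x)
    (hA : ∀ x, σ.SameCycle m x → B x (σ x) = A x (σ x)) :
    cycleProd B τ m = cycleProd A σ m := by
  have hp : minimalPeriod τ m = minimalPeriod σ m :=
    minimalPeriod_eq_minimalPeriod_iff.2 fun k => by
      rw [IsPeriodicPt, IsPeriodicPt, IsFixedPt, IsFixedPt, iterate_congr h]
  simp only [cycleProd_eq_prod_range, hp, iterate_congr h]
  congr 1
  refine List.map_congr_left fun t _ => ?_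
  rw [iterate_succ_apply']
  exact hA _ (sameCycle_iterate σ m t)

lemma iterate_inv_eq {t : ℕ} (ht : t ≤ minimalPeriod σ m) :
    (⇑σ⁻¹)^[t] m = σ^[minimalPeriod σ m - t] m := by
  apply (σ.injective.iterate t)
  rw [← iterate_add_apply, Nat.add_sub_cancel' ht, iterate_minimalPeriod]
  exact (LeftInverse.iterate (fun x => by simp) t : LeftInverse σ^[t] (⇑σ⁻¹)^[t]) m

lemma star_prod_range [StarRing R] (f : ℕ → R) (p : ℕ) :
    star ((List.range p).map f).prod =
      ((List.range p).map fun t => star (f (p - 1 - t))).prod := by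
  induction p with
  | zero => simp
  | succ p ih =>
    rw [List.prod_range_succ, List.prod_range_succ', star_mul, ih]
    congr 2
    refine List.map_congr_left fun t _ => ?_
    congr 2
    omega

/-- Where `A` is Hermitian, reading a cycle backwards conjugates its product. -/
lemma cycleProd_inv [StarRing R]
    (hA : ∀ x y, σ.SameCycle m x → σ.SameCycle m y → star (A x y) = A y x) :
    cycleProd A σ⁻¹ m = star (cycleProd A σ m) := by
  have hp : minimalPeriod (⇑σ⁻¹) m = minimalPeriod σ m :=
    minimalPeriod_eq_minimalPeriod_iff.2 fun k => by
      rw [IsPeriodicPt, IsPeriodicPt, IsFixedPt, IsFixedPt, iterate_eq_pow, iterate_eq_pow,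
        inv_pow, inv_eq_iff_eq, eq_comm]
  rw [cycleProd_eq_prod_range, cycleProd_eq_prod_range, hp, star_prod_range]
  congr 1
  refine List.map_congr_left fun t ht => ?_
  rw [List.mem_range] at ht
  have h₁ : minimalPeriod σ m - 1 - t + 1 = minimalPeriod σ m - t := by omega
  have h₂ : minimalPeriod σ m - 1 - t = minimalPeriod σ m - (t + 1) := by omega
  rw [iterate_inv_eq ht.le, iterate_inv_eq ht,
    hA _ _ (sameCycle_iterate _ _ _) (sameCycle_iterate _ _ _), h₁, h₂]

end CycleProd

/-- The real part of a cycle product does not depend on the element at which the cycle is opened,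
because `Re (a * b) = Re (b * a)`. -/
lemma re_cycleProd_apply (A : Matrix (Fin n) (Fin n) (Quaternion ℝ)) (σ : Equiv.Perm (Fin n))
    (m : Fin n) : (cycleProd A σ (σ m)).re = (cycleProd A σ m).re := by
  have re_mul_comm (a b : Quaternion ℝ) : (a * b).re = (b * a).re := by
    simp only [Quaternion.re_mul]
    ring
  rw [cycleProd_eq_prod_range, cycleProd_eq_prod_range, minimalPeriod_apply (mem_periodicPts σ m)]
  have hp := minimalPeriod_pos_of_mem_periodicPts (mem_periodicPts σ m)
  have hσ : σ^[minimalPeriod σ m] m = m := iterate_minimalPeriod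
  revert hp hσ
  generalize minimalPeriod σ m = p
  intro hp hσ
  obtain ⟨p, rfl⟩ := Nat.exists_eq_add_of_lt hp
  rw [zero_add] at hσ ⊢
  rw [List.prod_range_succ, List.prod_range_succ', re_mul_comm]
  simp only [← iterate_succ_apply, hσ, iterate_zero, id_eq]
  rw [iterate_succ_apply' _ (p + 1), hσ]
  rfl

lemma re_cycleProd_eq (A : Matrix (Fin n) (Fin n) (Quaternion ℝ)) {σ : Equiv.Perm (Fin n)}
    {m k : Fin n} (h : σ.SameCycle m k) : (cycleProd A σ m).re = (cycleProd A σ k).re := by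
  obtain ⟨t, rfl⟩ := exists_iterate_eq h
  induction t with
  | zero => rfl
  | succ t ih =>
    rw [iterate_succ_apply', re_cycleProd_apply]
    exact ih (sameCycle_iterate _ _ _)

/-! ### Reversing one cycle -/

/-- The permutation obtained from `σ` by running through the cycle of `m` backwards. -/
def flipCycle (σ : Equiv.Perm (Fin n)) (m : Fin n) : Equiv.Perm (Fin n) :=
  σ * σ⁻¹.cycleOf m ^ 2

section flipCycle

variable {σ : Equiv.Perm (Fin n)} {m x y : Fin n}

lemma flipCycle_apply_of_sameCycle (h : σ.SameCycle m x) : flipCycle σ m x = σ⁻¹ x := by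
  have h' : σ⁻¹.SameCycle m x := sameCycle_inv.2 h
  have h2 : σ⁻¹.SameCycle m (σ⁻¹ x) := sameCycle_apply_right.2 h'
  rw [flipCycle, pow_two, mul_apply, mul_apply, h'.cycleOf_apply, h2.cycleOf_apply]
  simp

lemma flipCycle_apply_of_not_sameCycle (h : ¬ σ.SameCycle m x) : flipCycle σ m x = σ x := by
  have h' : ¬ σ⁻¹.SameCycle m x := fun h1 => h (sameCycle_inv.1 h1)
  simp only [flipCycle, pow_two, mul_apply, cycleOf_apply_of_not_sameCycle h']

lemma sign_flipCycle : sign (flipCycle σ m) = sign σ := by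
  simp [flipCycle, Int.units_sq]

lemma sameCycle_flipCycle : (flipCycle σ m).SameCycle x y ↔ σ.SameCycle x y := by
  by_cases h : σ.SameCycle m x
  · rw [← sameCycle_inv (f := σ)]
    exact sameCycle_congr (fun z hz => flipCycle_apply_of_sameCycle
      (h.trans (sameCycle_inv.1 hz))) y
  · exact sameCycle_congr (fun z hz => flipCycle_apply_of_not_sameCycle
      fun hm => h (hm.trans hz.symm)) y

lemma flipCycle_involutive (m : Fin n) :
    Involutive fun σ : Equiv.Perm (Fin n) => flipCycle σ m := by
  intro σ
  ext1 x
  by_cases h : σ.SameCycle m x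
  · rw [flipCycle_apply_of_sameCycle (sameCycle_flipCycle.2 h), inv_eq_iff_eq,
      flipCycle_apply_of_sameCycle (sameCycle_apply_right.2 h)]
    simp
  · rw [flipCycle_apply_of_not_sameCycle (fun h' => h (sameCycle_flipCycle.1 h')),
      flipCycle_apply_of_not_sameCycle h]

lemma cycleStarts_flipCycle (i : Fin n) : cycleStarts (flipCycle σ m) i = cycleStarts σ i := by
  simp only [cycleStarts, sameCycle_flipCycle]

variable {R : Type*} [Ring R] {A : Matrix (Fin n) (Fin n) R}

lemma cycleProd_flipCycle_of_not_sameCycle (h : ¬ σ.SameCycle m x) :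
    cycleProd A (flipCycle σ m) x = cycleProd A σ x :=
  cycleProd_congr (fun _ hz => flipCycle_apply_of_not_sameCycle
    fun hm => h (hm.trans hz.symm)) fun _ _ => rfl

lemma cycleProd_flipCycle_self [StarRing R]
    (hA : ∀ x y, σ.SameCycle m x → σ.SameCycle m y → star (A x y) = A y x) :
    cycleProd A (flipCycle σ m) m = star (cycleProd A σ m) := by
  rw [← cycleProd_inv hA]
  exact cycleProd_congr (fun z hz => flipCycle_apply_of_sameCycle (sameCycle_inv.1 hz))
    fun _ _ => rfl

/-- Averaging over `σ` and its flip at `m` does not change a sum over all permutations. -/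
lemma sum_eq_sum_of_add_flipCycle {M : Type*} [AddCommGroup M] [Module ℝ M] (m : Fin n)
    (f g : Equiv.Perm (Fin n) → M)
    (h : ∀ σ, f σ + f (flipCycle σ m) = g σ + g (flipCycle σ m)) :
    ∑ σ, f σ = ∑ σ, g σ := by
  have key (f : Equiv.Perm (Fin n) → M) :
      ∑ σ, (f σ + f (flipCycle σ m)) = (2 : ℝ) • ∑ σ, f σ := by
    rw [Finset.sum_add_distrib, two_smul]
    congr 1
    exact (flipCycle_involutive m).bijective.sum_comp f
  have h2 : (2 : ℝ) • ∑ σ, f σ = (2 : ℝ) • ∑ σ, g σ := by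
    rw [← key, ← key]
    exact Finset.sum_congr rfl fun σ _ => h σ
  exact smul_right_injective M (two_ne_zero' ℝ) h2

end flipCycle

/-! ### Cycle representatives -/

section Representatives

variable {σ : Equiv.Perm (Fin n)} {i m k : Fin n}

/-- The set of the smallest elements of the cycles of `σ`, fixed points included. -/
def cycleMins (σ : Equiv.Perm (Fin n)) : Finset (Fin n) :=
  {m | ∀ k, σ.SameCycle m k → m ≤ k}

lemma mem_cycleMins : m ∈ cycleMins σ ↔ ∀ k, σ.SameCycle m k → m ≤ k := by
  simp [cycleMins]

lemma eq_of_mem_cycleMins (hm : m ∈ cycleMins σ) (hk : k ∈ cycleMins σ)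
    (h : σ.SameCycle m k) : m = k :=
  le_antisymm (mem_cycleMins.1 hm k h) (mem_cycleMins.1 hk m h.symm)

lemma exists_mem_cycleMins (σ : Equiv.Perm (Fin n)) (k : Fin n) :
    ∃ m ∈ cycleMins σ, σ.SameCycle k m := by
  obtain ⟨m, hm, hmin⟩ := Finset.exists_min_image ({x | σ.SameCycle k x} : Finset (Fin n)) id
    ⟨k, by simp [SameCycle.refl]⟩
  simp only [Finset.mem_filter, Finset.mem_univ, true_and, id_eq] at hm hmin
  exact ⟨m, mem_cycleMins.2 fun x hx => hmin x (hm.trans hx), hm⟩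

/-- In a product over cycle representatives of a function that is constant on cycles, the factor
of the cycle of `k` can be read off at `k`. -/
lemma prod_cycleMins_filter_eq_mul {M : Type*} [CommMonoid M] (w : Fin n → M) (P : Fin n → Prop)
    [DecidablePred P] (hw : ∀ x y, σ.SameCycle x y → w x = w y)
    (hP : ∀ x, σ.SameCycle k x → P x) :
    ∏ m ∈ cycleMins σ with P m, w m =
      w k * ∏ m ∈ cycleMins σ with P m ∧ ¬ σ.SameCycle k m, w m := by
  obtain ⟨m₀, hm₀, hk⟩ := exists_mem_cycleMins σ k
  have hs : (cycleMins σ).filter P =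
      insert m₀ ((cycleMins σ).filter fun m => P m ∧ ¬ σ.SameCycle k m) := by
    ext m
    simp only [Finset.mem_filter, Finset.mem_insert]
    constructor
    · rintro ⟨hm, hPm⟩
      by_cases h : σ.SameCycle k m
      · exact Or.inl (eq_of_mem_cycleMins hm hm₀ (h.symm.trans hk))
      · exact Or.inr ⟨hm, hPm, h⟩
    · rintro (rfl | ⟨hm, hPm, -⟩)
      · exact ⟨hm₀, hP _ hk⟩
      · exact ⟨hm, hPm⟩
  rw [hs, Finset.prod_insert (by simp [hk]), hw k m₀ hk]

lemma mem_cycleStarts :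
    m ∈ cycleStarts σ i ↔ m = i ∨ ¬ σ.SameCycle i m ∧ m ∈ cycleMins σ := by
  simp [cycleStarts, mem_cycleMins]

lemma nodup_cycleStarts (σ : Equiv.Perm (Fin n)) (i : Fin n) : (cycleStarts σ i).Nodup :=
  List.nodup_cons.2 ⟨by simp [SameCycle.refl], (List.nodup_finRange n).filter _⟩

lemma not_sameCycle_of_mem_cycleStarts (hm : m ∈ cycleStarts σ i) (hk : k ∈ cycleStarts σ i)
    (hmk : m ≠ k) : ¬ σ.SameCycle m k := by
  intro h
  rw [mem_cycleStarts] at hm hk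
  rcases hm with rfl | hm <;> rcases hk with rfl | hk
  · exact hmk rfl
  · exact hk.1 h
  · exact hm.1 h.symm
  · exact hmk (eq_of_mem_cycleMins hm.2 hk.2 h)

/-- If the factors of all cycles but that of `i` are real scalars, their order no longer matters:
the ordered product becomes a product over a finite set of representatives. -/
lemma prod_map_cycleStarts {R : Type*} [Ring R] (σ : Equiv.Perm (Fin n)) (i : Fin n)
    (f : Fin n → R) (w : Fin n → ℝ) (φ : ℝ →+* R)
    (hf : ∀ m, ¬ σ.SameCycle i m → f m = φ (w m)) :
    ((cycleStarts σ i).map f).prod =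
      f i * φ (∏ m ∈ cycleMins σ with ¬ σ.SameCycle i m, w m) := by
  rw [cycleStarts, List.map_cons, List.prod_cons]
  congr 1
  have hs : (cycleMins σ).filter (fun m => ¬ σ.SameCycle i m) =
      ((List.finRange n).filter
        fun m => ¬ σ.SameCycle i m ∧ ∀ k, σ.SameCycle m k → m ≤ k).toFinset := by
    ext m
    simp [mem_cycleMins, and_comm]
  rw [hs, List.prod_toFinset _ ((List.nodup_finRange n).filter _), map_list_prod, List.map_map]
  congr 1
  refine List.map_congr_left fun m hm => hf m ?_
  simp only [List.mem_filter, decide_eq_true_eq] at hm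
  exact hm.2.1

end Representatives

/-! ### Replacing cycle products by their real parts -/

section Averaging

variable {A : Matrix (Fin n) (Fin n) (Quaternion ℝ)} {i : Fin n}

/-- A noncommutative product is additive in its factor at `m`. -/
lemma prod_map_add_prod_map {R α : Type*} [Ring R] {L : List α} (hL : L.Nodup) {m : α}
    (hm : m ∈ L) {f f' g g' : α → R}
    (hf' : ∀ x ∈ L, x ≠ m → f' x = f x) (hg : ∀ x ∈ L, x ≠ m → g x = f x)
    (hg' : ∀ x ∈ L, x ≠ m → g' x = f x) (h : f m + f' m = g m + g' m) :
    (L.map f).prod + (L.map f').prod = (L.map g).prod + (L.map g').prod := by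
  obtain ⟨l₁, l₂, rfl⟩ := List.append_of_mem hm
  have h₁ : ∀ x ∈ l₁, x ≠ m := by
    rintro x hx rfl
    exact (List.nodup_append.1 hL).2.2 x hx x (by simp) rfl
  have h₂ : ∀ x ∈ l₂, x ≠ m := by
    rintro x hx rfl
    exact (List.nodup_cons.1 (List.nodup_append.1 hL).2.1).1 hx
  have e (u : α → R) (hu : ∀ x ∈ l₁ ++ m :: l₂, x ≠ m → u x = f x) :
      ((l₁ ++ m :: l₂).map u).prod = (l₁.map f).prod * u m * (l₂.map f).prod := by
    rw [List.map_append, List.map_cons, List.prod_append, List.prod_cons, ← mul_assoc,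
      List.map_congr_left fun x hx => hu x (by simp [hx]) (h₁ x hx),
      List.map_congr_left fun x hx => hu x (by simp [hx]) (h₂ x hx)]
  rw [e f fun _ _ _ => rfl, e f' hf', e g hg, e g' hg', ← add_mul, ← mul_add, h, mul_add, add_mul]

/-- The product along the cycle of `σ` through `m`, replaced by its real part if `m ∈ s`. -/
noncomputable def partialRe (A : Matrix (Fin n) (Fin n) (Quaternion ℝ))
    (s : Finset (Fin n)) (σ : Equiv.Perm (Fin n)) (m : Fin n) : Quaternion ℝ :=
  if m ∈ s then ((cycleProd A σ m).re : Quaternion ℝ) else cycleProd A σ m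

lemma sum_partialRe_insert (s : Finset (Fin n)) (m : Fin n)
    (hm : ∀ σ : Equiv.Perm (Fin n), m ∈ cycleStarts σ i →
      ∀ x y, σ.SameCycle m x → σ.SameCycle m y → star (A x y) = A y x) :
    ∑ σ, sign σ • ((cycleStarts σ i).map (partialRe A s σ)).prod =
      ∑ σ, sign σ • ((cycleStarts σ i).map (partialRe A (insert m s) σ)).prod := by
  refine sum_eq_sum_of_add_flipCycle m _ _ fun σ => ?_
  rw [sign_flipCycle, cycleStarts_flipCycle, ← smul_add, ← smul_add]
  congr 1
  by_cases hmem : m ∈ cycleStarts σ i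
  · have hflip {x : Fin n} (hx : x ∈ cycleStarts σ i) (hxm : x ≠ m) :
        cycleProd A (flipCycle σ m) x = cycleProd A σ x :=
      cycleProd_flipCycle_of_not_sameCycle
        (not_sameCycle_of_mem_cycleStarts hmem hx hxm.symm)
    refine prod_map_add_prod_map (nodup_cycleStarts σ i) hmem
      (fun x hx hxm => ?_) (fun x hx hxm => ?_) (fun x hx hxm => ?_) ?_
    · simp only [partialRe, hflip hx hxm]
    · simp only [partialRe, Finset.mem_insert, hxm, false_or]
    · simp only [partialRe, Finset.mem_insert, hxm, false_or, hflip hx hxm]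
    · simp only [partialRe, Finset.mem_insert, true_or, if_true,
        cycleProd_flipCycle_self (hm σ hmem), Quaternion.re_star]
      split_ifs
      · rfl
      · rw [Quaternion.self_add_star', two_mul, Quaternion.coe_add]
  · have hins (τ : Equiv.Perm (Fin n)) :
        (cycleStarts σ i).map (partialRe A (insert m s) τ) =
          (cycleStarts σ i).map (partialRe A s τ) := by
      refine List.map_congr_left fun x hx => ?_
      have hxm : x ≠ m := fun h => hmem (h ▸ hx)
      simp only [partialRe, Finset.mem_insert, hxm, false_or]
    rw [hins, hins]

/-- A row determinant does not change when cycle products are replaced by their real parts, as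
long as the cycles concerned only involve Hermitian entries: flipping such a cycle conjugates its
product and preserves the sign and the remaining factors. -/
lemma rdet_eq_sum_partialRe (s : Finset (Fin n))
    (hs : ∀ m ∈ s, ∀ σ : Equiv.Perm (Fin n), m ∈ cycleStarts σ i →
      ∀ x y, σ.SameCycle m x → σ.SameCycle m y → star (A x y) = A y x) :
    rdet i A = ∑ σ, sign σ • ((cycleStarts σ i).map (partialRe A s σ)).prod := by
  induction s using Finset.induction_on with
  | empty =>
    have h (σ : Equiv.Perm (Fin n)) : partialRe A ∅ σ = cycleProd A σ := by
      ext1 m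
      simp [partialRe]
    simp only [rdet, h]
  | insert m s _ ih =>
    rw [ih fun k hk => hs k (Finset.mem_insert_of_mem hk),
      sum_partialRe_insert s m (hs m (Finset.mem_insert_self m s))]

/-- The signed sum over all permutations of the product, over the cycles, of the real parts of the
cycle products. For a Hermitian matrix this is the common value of the row and column
determinants. -/
noncomputable def reDet (A : Matrix (Fin n) (Fin n) (Quaternion ℝ)) : ℝ :=
  ∑ σ : Equiv.Perm (Fin n), sign σ • ∏ m ∈ cycleMins σ, (cycleProd A σ m).re

lemma rdet_eq_reDet (hA : A.IsHermitian) (i : Fin n) : rdet i A = (reDet A : Quaternion ℝ) := by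
  have hstar (x y : Fin n) : star (A x y) = A y x := hA.apply y x
  rw [rdet_eq_sum_partialRe Finset.univ fun _ _ _ _ x y _ _ => hstar x y,
    ← Quaternion.algebraMap_def, reDet, map_sum]
  refine Finset.sum_congr rfl fun σ _ => ?_
  rw [Units.smul_def, Units.smul_def, map_zsmul]
  congr 1
  rw [prod_map_cycleStarts σ i _ (fun m => (cycleProd A σ m).re) (algebraMap ℝ (Quaternion ℝ))
    fun m _ => by simp [partialRe, Quaternion.algebraMap_def]]
  have h := prod_cycleMins_filter_eq_mul (σ := σ) (k := i) (fun m => (cycleProd A σ m).re)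
    (fun _ => True) (fun x y h => re_cycleProd_eq A h) fun _ _ => trivial
  simp only [Finset.filter_true, true_and] at h
  rw [h, map_mul]
  simp [partialRe, Quaternion.algebraMap_def]

lemma cdet_eq_star_rdet (hA : A.IsHermitian) (j : Fin n) : cdet j A = star (rdet j A) := by
  have hstar (x y : Fin n) : star (A x y) = A y x := hA.apply y x
  rw [rdet, cdet, star_sum]
  refine Fintype.sum_equiv (Equiv.inv _) _ _ fun σ => ?_
  have hL : cycleStarts σ⁻¹ j = cycleStarts σ j := by simp only [cycleStarts, sameCycle_inv]
  rw [Equiv.inv_apply, sign_inv, Units.smul_def, Units.smul_def, star_zsmul, hL]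
  congr 1
  generalize cycleStarts σ j = L
  induction L with
  | nil => simp
  | cons m L ih =>
    rw [List.reverse_cons, List.map_append, List.prod_append, ih, List.map_singleton,
      List.prod_singleton, List.map_cons, List.prod_cons, star_mul,
      cycleProd_inv fun x y _ _ => hstar x y, star_star]

lemma hermDet_eq_reDet (hA : A.IsHermitian) : hermDet A = (reDet A : Quaternion ℝ) := by
  cases n with
  | zero => simp [hermDet, reDet, cycleMins]
  | succ n => exact rdet_eq_reDet hA 0

end Averaging

/-! ### Merging two cycles -/

section Merge

variable {σ : Equiv.Perm (Fin n)} {i k : Fin n}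

lemma mul_swap_apply_left (σ : Equiv.Perm (Fin n)) (i k : Fin n) :
    (σ * Equiv.swap i k) i = σ k := by simp

lemma mul_swap_apply_right (σ : Equiv.Perm (Fin n)) (i k : Fin n) :
    (σ * Equiv.swap i k) k = σ i := by simp

lemma mul_swap_apply_of_ne {x : Fin n} (hi : x ≠ i) (hk : x ≠ k) :
    (σ * Equiv.swap i k) x = σ x := by
  rw [mul_apply, Equiv.swap_apply_of_ne_of_ne hi hk]

lemma mul_swap_apply_of_not_sameCycle {x z : Fin n} (hi : ¬ σ.SameCycle i x)
    (hk : ¬ σ.SameCycle k x) (hz : σ.SameCycle x z) : (σ * Equiv.swap i k) z = σ z := by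
  refine mul_swap_apply_of_ne ?_ ?_
  · rintro rfl
    exact hi hz.symm
  · rintro rfl
    exact hk hz.symm

lemma sameCycle_mul_swap_of_not_sameCycle {x y : Fin n} (hi : ¬ σ.SameCycle i x)
    (hk : ¬ σ.SameCycle k x) : (σ * Equiv.swap i k).SameCycle x y ↔ σ.SameCycle x y :=
  sameCycle_congr (fun _ => mul_swap_apply_of_not_sameCycle hi hk) y

lemma iterate_mul_swap {t : ℕ} (ht : 0 < t)
    (h : ∀ s, 0 < s → s < t → σ^[s] k ≠ i ∧ σ^[s] k ≠ k) :
    (⇑(σ * Equiv.swap i k))^[t] i = σ^[t] k := by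
  induction t, ht using Nat.le_induction with
  | base => simp
  | succ t ht ih =>
    rw [iterate_succ_apply', ih fun s hs hst => h s hs (by omega), iterate_succ_apply',
      mul_swap_apply_of_ne (h t ht (by omega)).1 (h t ht (by omega)).2]

/-- If `i` and `k` lie in different cycles of `σ`, then the cycle of `i` in `σ * swap i k`
begins with the cycle of `k` in `σ`, opened behind `k`. -/
lemma iterate_mul_swap_of_le (h : ¬ σ.SameCycle i k) {t : ℕ} (ht : 0 < t)
    (htk : t ≤ minimalPeriod σ k) : (⇑(σ * Equiv.swap i k))^[t] i = σ^[t] k := by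
  refine iterate_mul_swap ht fun s hs hst => ⟨fun he => h ?_, fun he => ?_⟩
  · rw [← he]
    exact (sameCycle_iterate σ k s).symm
  · exact absurd (IsPeriodicPt.minimalPeriod_le hs he) (by omega)

/-- After the cycle of `k` in `σ`, the cycle of `i` in `σ * swap i k` continues with the cycle of `i`
in `σ`. -/
lemma iterate_add_mul_swap_of_le (h : ¬ σ.SameCycle i k) {t : ℕ} (ht : 0 < t)
    (hti : t ≤ minimalPeriod σ i) :
    (⇑(σ * Equiv.swap i k))^[minimalPeriod σ k + t] i = σ^[t] i := by
  have hk := minimalPeriod_pos_of_mem_periodicPts (mem_periodicPts σ k)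
  rw [add_comm, iterate_add_apply, iterate_mul_swap_of_le h hk le_rfl, iterate_minimalPeriod,
    Equiv.swap_comm]
  exact iterate_mul_swap_of_le (fun h' => h h'.symm) ht hti

lemma sameCycle_mul_swap (h : ¬ σ.SameCycle i k) {x : Fin n} :
    (σ * Equiv.swap i k).SameCycle i x ↔ σ.SameCycle i x ∨ σ.SameCycle k x := by
  constructor
  · intro hx
    by_contra! hc
    exact hc.1 ((sameCycle_mul_swap_of_not_sameCycle hc.1 hc.2).1 hx.symm).symm
  · have hik : (σ * Equiv.swap i k).SameCycle i k := by
      have hk := minimalPeriod_pos_of_mem_periodicPts (mem_periodicPts σ k)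
      have := sameCycle_iterate (σ * Equiv.swap i k) i (minimalPeriod σ k)
      rwa [iterate_mul_swap_of_le h hk le_rfl, iterate_minimalPeriod] at this
    -- The cycle of `i` in `σ * swap i k` is closed under `σ`, because it contains `i` and `k`.
    have hstep (y : Fin n) (hy : (σ * Equiv.swap i k).SameCycle i y) :
        (σ * Equiv.swap i k).SameCycle i (σ y) := by
      by_cases hyi : y = i
      · rw [hyi, ← mul_swap_apply_right σ i k]
        exact sameCycle_apply_right.2 hik
      by_cases hyk : y = k
      · rw [hyk, ← mul_swap_apply_left σ i k]
        exact sameCycle_apply_right.2 (SameCycle.refl _ _)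
      · rw [← mul_swap_apply_of_ne hyi hyk]
        exact sameCycle_apply_right.2 hy
    have hiter (y : Fin n) (hy : (σ * Equiv.swap i k).SameCycle i y) (t : ℕ) :
        (σ * Equiv.swap i k).SameCycle i (σ^[t] y) := by
      induction t with
      | zero => exact hy
      | succ t ih =>
        rw [iterate_succ_apply']
        exact hstep _ ih
    rintro (hx | hx)
    · obtain ⟨t, rfl⟩ := exists_iterate_eq hx
      exact hiter i (SameCycle.refl _ _) t
    · obtain ⟨t, rfl⟩ := exists_iterate_eq hx
      exact hiter k hik t

/-- Multiplying by `swap i k` splits a cycle that contains both `i` and `k`. -/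
lemma not_sameCycle_mul_swap (hik : i ≠ k) (h : σ.SameCycle i k) :
    ¬ (σ * Equiv.swap i k).SameCycle i k := by
  have hex := exists_iterate_eq h
  set t := Nat.find hex
  have htk : σ^[t] i = k := Nat.find_spec hex
  have hmin {s : ℕ} (hs : s < t) : σ^[s] i ≠ k := Nat.find_min hex hs
  have ht0 : 0 < t := by
    rcases Nat.eq_zero_or_pos t with h0 | h0
    · rw [h0] at htk
      exact absurd htk hik
    · exact h0
  have hne {s : ℕ} (hs : 0 < s) (hst : s < t) : σ^[s] i ≠ i := by
    intro he
    refine hmin (s := t - s) (by omega) ?_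
    rw [← htk]
    conv_rhs => rw [← Nat.sub_add_cancel hst.le, iterate_add_apply, he]
  have hiter {s : ℕ} (hs : 0 < s) (hst : s ≤ t) :
      (⇑(σ * Equiv.swap i k))^[s] k = σ^[s] i := by
    rw [Equiv.swap_comm]
    exact iterate_mul_swap hs fun r hr hrs => ⟨hmin (by omega), hne hr (by omega)⟩
  intro hsame
  obtain ⟨r, hr⟩ := exists_iterate_eq hsame.symm
  have hper : IsPeriodicPt (⇑(σ * Equiv.swap i k)) t k := by
    rw [IsPeriodicPt, IsFixedPt, hiter ht0 le_rfl, htk]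
  rw [← hper.iterate_mod_apply] at hr
  rcases Nat.eq_zero_or_pos (r % t) with h0 | h0
  · rw [h0] at hr
    exact hik hr.symm
  · rw [hiter h0 (Nat.mod_lt _ ht0).le] at hr
    exact hne h0 (Nat.mod_lt _ ht0) hr

/-- If the rows `i` and `k` of `A` agree, merging the cycles of `i` and `k` concatenates the
products along them. -/
lemma cycleProd_mul_swap {R : Type*} [Ring R] {A : Matrix (Fin n) (Fin n) R} (hA : A i = A k)
    (h : ¬ σ.SameCycle i k) :
    cycleProd A (σ * Equiv.swap i k) i = cycleProd A σ k * cycleProd A σ i := by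
  have hq := minimalPeriod_pos_of_mem_periodicPts (mem_periodicPts σ k)
  have hp := minimalPeriod_pos_of_mem_periodicPts (mem_periodicPts σ i)
  have hper : minimalPeriod (⇑(σ * Equiv.swap i k)) i =
      minimalPeriod σ k + minimalPeriod σ i := by
    refine le_antisymm (IsPeriodicPt.minimalPeriod_le (by omega) ?_) ?_
    · rw [IsPeriodicPt, IsFixedPt, iterate_add_mul_swap_of_le h hp le_rfl, iterate_minimalPeriod]
    · by_contra! hlt
      have hr := minimalPeriod_pos_of_mem_periodicPts (mem_periodicPts (σ * Equiv.swap i k) i)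
      have hfix := iterate_minimalPeriod (f := ⇑(σ * Equiv.swap i k)) (x := i)
      generalize minimalPeriod (⇑(σ * Equiv.swap i k)) i = r at hlt hr hfix
      rcases le_or_gt r (minimalPeriod σ k) with hle | hgt
      · rw [iterate_mul_swap_of_le h hr hle] at hfix
        apply h
        rw [← hfix]
        exact (sameCycle_iterate σ k r).symm
      · obtain ⟨t, rfl⟩ := Nat.exists_eq_add_of_lt hgt
        rw [add_assoc, iterate_add_mul_swap_of_le h (by omega) (by omega)] at hfix
        exact absurd (IsPeriodicPt.minimalPeriod_le (by omega) hfix) (by omega)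
  rw [cycleProd_eq_prod_range, hper, List.range_add, List.map_append, List.prod_append,
    cycleProd_eq_prod_range, cycleProd_eq_prod_range, List.map_map]
  congr 2
  · refine List.map_congr_left fun t ht => ?_
    rw [List.mem_range] at ht
    rw [iterate_mul_swap_of_le h (Nat.succ_pos t) ht]
    rcases Nat.eq_zero_or_pos t with rfl | h0
    · exact congrFun hA _
    · rw [iterate_mul_swap_of_le h h0 ht.le]
  · refine List.map_congr_left fun t ht => ?_
    rw [List.mem_range] at ht
    rw [comp_apply, add_assoc, iterate_add_mul_swap_of_le h (Nat.succ_pos t) ht]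
    rcases Nat.eq_zero_or_pos t with rfl | h0
    · rw [add_zero, iterate_mul_swap_of_le h hq le_rfl, iterate_minimalPeriod]
      exact (congrFun hA _).symm
    · rw [iterate_add_mul_swap_of_le h h0 ht.le]

end Merge

/-! ### Row determinants with two equal rows -/

section EqualRows

variable {A : Matrix (Fin n) (Fin n) (Quaternion ℝ)} {i k : Fin n}

/-- If the rows `i` and `k` of `A` agree and `A` is Hermitian off the row and column `i`, then
`rdet i A = 0`: the permutation `σ * swap i k` cancels `σ`. If `i` and `k` lie in different cycles
of `σ`, the summand of `σ * swap i k` has the product along the cycle of `k` where that of `σ` has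
its real part, a difference which disappears on flipping that cycle of `σ`. -/
lemma rdet_eq_zero_of_row_eq (hik : i ≠ k) (hrow : A i = A k)
    (hA : ∀ x y, x ≠ i → y ≠ i → star (A x y) = A y x) : rdet i A = 0 := by
  set φ := algebraMap ℝ (Quaternion ℝ) with hφ
  have hcomm (r : ℝ) (a : Quaternion ℝ) : φ r * a = a * φ r := Algebra.commutes r a
  have hherm {σ : Equiv.Perm (Fin n)} {m : Fin n} (hm : ¬ σ.SameCycle i m) (x y : Fin n)
      (hx : σ.SameCycle m x) (hy : σ.SameCycle m y) : star (A x y) = A y x := by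
    refine hA x y ?_ ?_
    · rintro rfl
      exact hm hx.symm
    · rintro rfl
      exact hm hy.symm
  set T : Equiv.Perm (Fin n) → Quaternion ℝ := fun σ => sign σ • (cycleProd A σ i *
    φ (∏ m ∈ cycleMins σ with ¬ σ.SameCycle i m, (cycleProd A σ m).re)) with hT
  set Q : Equiv.Perm (Fin n) → Quaternion ℝ := fun σ => cycleProd A σ i *
    φ (∏ m ∈ cycleMins σ with ¬ σ.SameCycle i m ∧ ¬ σ.SameCycle k m, (cycleProd A σ m).re) with hQ
  have hsum : rdet i A = ∑ σ, T σ := by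
    rw [rdet_eq_sum_partialRe (Finset.univ.erase i) fun m hm σ hmem => ?_]
    · refine Finset.sum_congr rfl fun σ _ => ?_
      rw [hT, prod_map_cycleStarts σ i _ (fun m => (cycleProd A σ m).re) φ fun m hm => ?_]
      · simp [partialRe]
      · have hmi : m ≠ i := by
          rintro rfl
          exact hm (SameCycle.refl _ _)
        simp [partialRe, hmi, hφ, Quaternion.algebraMap_def]
    · rcases mem_cycleStarts.1 hmem with rfl | hm'
      · simp at hm
      · exact hherm hm'.1
  -- In the summand of a separated `σ`, pull out the real part belonging to the cycle of `k`.
  have hsep {σ : Equiv.Perm (Fin n)} (h : ¬ σ.SameCycle i k) :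
      T σ = sign σ • (φ (cycleProd A σ k).re * Q σ) := by
    simp only [hT, hQ]
    rw [prod_cycleMins_filter_eq_mul (k := k) (fun m => (cycleProd A σ m).re)
      (fun m => ¬ σ.SameCycle i m) (fun x y h => re_cycleProd_eq A h)
      (fun x hx h' => h (h'.trans hx.symm)), map_mul, ← mul_assoc, ← mul_assoc, hcomm]
  have hmerge {σ : Equiv.Perm (Fin n)} (h : ¬ σ.SameCycle i k) :
      T (σ * Equiv.swap i k) = -(sign σ • (cycleProd A σ k * Q σ)) := by
    simp only [hT, hQ]
    rw [cycleProd_mul_swap hrow h, Equiv.Perm.sign_mul, sign_swap hik, mul_neg_one, Units.neg_smul,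
      mul_assoc]
    congr 5
    have hiff (x : Fin n) : ¬ (σ * Equiv.swap i k).SameCycle i x ↔
        ¬ σ.SameCycle i x ∧ ¬ σ.SameCycle k x := by
      rw [sameCycle_mul_swap h, not_or]
    refine Finset.prod_congr ?_ fun x hx => ?_
    · ext x
      simp only [Finset.mem_filter, hiff, and_congr_left_iff, mem_cycleMins]
      intro hx
      simp only [sameCycle_mul_swap_of_not_sameCycle hx.1 hx.2]
    · have hx' := (Finset.mem_filter.1 hx).2
      rw [cycleProd_congr (fun z => mul_swap_apply_of_not_sameCycle hx'.1 hx'.2) fun z hz => rfl]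
  have hsplit : ∑ σ, T σ = ∑ σ : Equiv.Perm (Fin n),
      if σ.SameCycle i k then 0 else T σ + T (σ * Equiv.swap i k) := by
    have e : ∑ σ : Equiv.Perm (Fin n), (if σ.SameCycle i k then T σ else 0) =
        ∑ σ : Equiv.Perm (Fin n), if σ.SameCycle i k then 0 else T (σ * Equiv.swap i k) := by
      refine Fintype.sum_equiv (Equiv.mulRight (Equiv.swap i k)) _ _ fun σ => ?_
      rw [Equiv.coe_mulRight, mul_assoc, Equiv.swap_mul_self, mul_one]
      by_cases h : σ.SameCycle i k
      · rw [if_pos h, if_neg (not_sameCycle_mul_swap hik h)]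
      · rw [if_neg h, if_pos ((sameCycle_mul_swap h).2 (Or.inr (SameCycle.refl _ _)))]
    have e' : ∑ σ, T σ = ∑ σ : Equiv.Perm (Fin n), (if σ.SameCycle i k then 0 else T σ) +
        ∑ σ : Equiv.Perm (Fin n), if σ.SameCycle i k then T σ else 0 := by
      rw [← Finset.sum_add_distrib]
      refine Finset.sum_congr rfl fun σ _ => ?_
      split_ifs <;> simp
    rw [e', e, ← Finset.sum_add_distrib]
    refine Finset.sum_congr rfl fun σ _ => ?_
    split_ifs <;> simp
  have hflip : ∑ σ : Equiv.Perm (Fin n),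
        (if σ.SameCycle i k then 0 else sign σ • (φ (cycleProd A σ k).re * Q σ)) =
      ∑ σ : Equiv.Perm (Fin n),
        if σ.SameCycle i k then 0 else sign σ • (cycleProd A σ k * Q σ) := by
    refine sum_eq_sum_of_add_flipCycle k _ _ fun σ => ?_
    simp only [sameCycle_flipCycle, sign_flipCycle]
    split_ifs with h
    · rfl
    have hQ' : Q (flipCycle σ k) = Q σ := by
      have hmins : cycleMins (flipCycle σ k) = cycleMins σ := by
        simp only [cycleMins, sameCycle_flipCycle]
      simp only [hQ, sameCycle_flipCycle, hmins]
      rw [cycleProd_flipCycle_of_not_sameCycle fun h' => h h'.symm]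
      congr 2
      refine Finset.prod_congr rfl fun x hx => ?_
      rw [cycleProd_flipCycle_of_not_sameCycle (Finset.mem_filter.1 hx).2.2]
    rw [hQ', cycleProd_flipCycle_self (hherm h), Quaternion.re_star, ← smul_add, ← smul_add,
      ← add_mul, ← add_mul, ← map_add, Quaternion.self_add_star', two_mul, hφ,
      Quaternion.algebraMap_def]
  rw [hsum, hsplit]
  have hfinal : ∑ σ : Equiv.Perm (Fin n),
        (if σ.SameCycle i k then 0 else T σ + T (σ * Equiv.swap i k)) =
      ∑ σ : Equiv.Perm (Fin n),
          (if σ.SameCycle i k then 0 else sign σ • (φ (cycleProd A σ k).re * Q σ)) -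
        ∑ σ : Equiv.Perm (Fin n),
          if σ.SameCycle i k then 0 else sign σ • (cycleProd A σ k * Q σ) := by
    rw [← Finset.sum_sub_distrib]
    refine Finset.sum_congr rfl fun σ _ => ?_
    split_ifs with h
    · simp
    · rw [hmerge h, hsep h, sub_eq_add_neg]
  rw [hfinal, hflip, sub_self]

end EqualRows

/-! ### Cofactors and the Cramer rule -/

section Cramer

/-- Expansion along the row `i`: every monomial of `rdet i` contains exactly one entry of that row,
at its very left. -/
lemma exists_cofactors {R : Type*} [Ring R] (A : Matrix (Fin n) (Fin n) R) (i : Fin n) :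
    ∃ c : Fin n → R, ∀ y : Fin n → R, rdet i (A.updateRow i y) = y ⬝ᵥ c := by
  have hmon (σ : Equiv.Perm (Fin n)) : ∃ r : R, ∀ y : Fin n → R,
      sign σ • ((cycleStarts σ i).map (cycleProd (A.updateRow i y) σ)).prod = y (σ i) * r := by
    obtain ⟨p, hp⟩ := Nat.exists_eq_add_of_lt
      (minimalPeriod_pos_of_mem_periodicPts (mem_periodicPts σ i))
    rw [zero_add] at hp
    refine ⟨sign σ • (((List.range p).map fun t => A (σ^[t + 1] i) (σ^[t + 2] i)).prod *
      ((cycleStarts σ i).tail.map (cycleProd A σ)).prod), fun y => ?_⟩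
    rw [cycleStarts, List.map_cons, List.prod_cons, List.tail_cons, cycleProd_eq_prod_range, hp,
      List.prod_range_succ', mul_smul_comm, ← mul_assoc]
    congr 2
    · congr 1
      · simp
      · congr 1
        refine List.map_congr_left fun t ht => ?_
        rw [List.mem_range] at ht
        have hne : σ^[t + 1] i ≠ i := fun h =>
          absurd (IsPeriodicPt.minimalPeriod_le (Nat.succ_pos t) h) (by omega)
        exact congrFun (Matrix.updateRow_ne hne) _
    · congr 1
      refine List.map_congr_left fun m hm => ?_
      simp only [List.mem_filter, decide_eq_true_eq] at hm
      refine cycleProd_congr (fun _ _ => rfl) fun x hx => ?_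
      have hne : x ≠ i := by
        rintro rfl
        exact hm.2.1 hx.symm
      exact congrFun (Matrix.updateRow_ne hne) _
  choose r hr using hmon
  refine ⟨fun j => ∑ σ : Equiv.Perm (Fin n) with σ i = j, r σ, fun y => ?_⟩
  simp only [rdet, hr, dotProduct, Finset.mul_sum]
  rw [← Finset.sum_fiberwise (g := fun σ : Equiv.Perm (Fin n) => σ i)]
  refine Finset.sum_congr rfl fun j _ => Finset.sum_congr rfl fun σ hσ => ?_
  rw [(Finset.mem_filter.1 hσ).2]

variable {A : Matrix (Fin n) (Fin n) (Quaternion ℝ)}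

lemma rdet_updateRow_row (hA : A.IsHermitian) (i k : Fin n) :
    rdet i (A.updateRow i (A k)) = if k = i then (reDet A : Quaternion ℝ) else 0 := by
  split_ifs with h
  · rw [h, Matrix.updateRow_eq_self, rdet_eq_reDet hA]
  · refine rdet_eq_zero_of_row_eq (Ne.symm h) ?_ fun x y hx hy => ?_
    · rw [Matrix.updateRow_self, Matrix.updateRow_ne h]
    · rw [Matrix.updateRow_ne hx, Matrix.updateRow_ne hy]
      exact hA.apply y x

lemma vecMul_eq_iff_of_reDet_ne_zero (hA : A.IsHermitian) (hd : reDet A ≠ 0)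
    (x y : Fin n → Quaternion ℝ) :
    Matrix.vecMul x A = y ↔
      ∀ i, x i = rdet i (A.updateRow i y) / (reDet A : Quaternion ℝ) := by
  choose c hc using exists_cofactors A
  have hd' : (reDet A : Quaternion ℝ) ≠ 0 := by
    rw [Ne, ← Quaternion.coe_zero, Quaternion.coe_inj]
    exact hd
  set C : Matrix (Fin n) (Fin n) (Quaternion ℝ) := Matrix.of fun j i => c i j
  have hAC : A * C = (reDet A) • (1 : Matrix (Fin n) (Fin n) (Quaternion ℝ)) := by
    ext1 k i
    rw [Matrix.mul_apply']
    change A k ⬝ᵥ c i = _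
    rw [← hc, rdet_updateRow_row hA, Matrix.smul_apply, Matrix.one_apply]
    split_ifs
    · rw [← Quaternion.coe_mul_eq_smul, mul_one]
    · rw [smul_zero]
  -- Taking conjugate transposes turns the right inverse into a left inverse.
  have hCA' : C.conjTranspose * A = (reDet A) • (1 : Matrix (Fin n) (Fin n) (Quaternion ℝ)) := by
    have h := congrArg Matrix.conjTranspose hAC
    have hone : (reDet A • (1 : Matrix (Fin n) (Fin n) (Quaternion ℝ))).conjTranspose =
        reDet A • 1 := by
      ext1 j k
      rw [Matrix.conjTranspose_apply, Matrix.smul_apply, Matrix.smul_apply, Quaternion.star_smul,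
        ← Matrix.conjTranspose_apply, Matrix.conjTranspose_one]
    rwa [Matrix.conjTranspose_mul, hA.eq, hone] at h
  have hCC : C.conjTranspose = C := by
    have h : reDet A • C.conjTranspose = reDet A • C := by
      calc reDet A • C.conjTranspose = C.conjTranspose * (A * C) := by
            rw [hAC, Matrix.mul_smul, mul_one]
        _ = reDet A • C := by rw [← mul_assoc, hCA', Matrix.smul_mul, one_mul]
    exact smul_right_injective _ hd h
  have hCA : C * A = (reDet A) • (1 : Matrix (Fin n) (Fin n) (Quaternion ℝ)) := by
    rw [← hCA', hCC]
  have hdiv (i : Fin n) : x i = rdet i (A.updateRow i y) / (reDet A : Quaternion ℝ) ↔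
      reDet A • x i = Matrix.vecMul y C i := by
    rw [eq_div_iff hd', hc, Quaternion.mul_coe_eq_smul]
    rfl
  simp only [hdiv]
  constructor
  · rintro rfl i
    rw [Matrix.vecMul_vecMul, hAC, Matrix.vecMul_smul, Matrix.vecMul_one, Pi.smul_apply]
  · intro h
    have h' : reDet A • x = Matrix.vecMul y C := funext h
    have h2 : reDet A • Matrix.vecMul x A = reDet A • y := by
      rw [← Matrix.smul_vecMul, h', Matrix.vecMul_vecMul, hCA, Matrix.vecMul_smul,
        Matrix.vecMul_one]
    exact smul_right_injective _ hd h2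

end Cramer

end RowColumnDet

theorem theorem9p4 (n : ℕ) (A : Matrix (Fin n) (Fin n) (Quaternion ℝ)) (hA : A.IsHermitian) :
    (∀ k : Fin n, RowColumnDet.rdet k A = RowColumnDet.hermDet A ∧
      RowColumnDet.cdet k A = RowColumnDet.hermDet A) ∧
    (∃ d : ℝ, RowColumnDet.hermDet A = (d : Quaternion ℝ)) ∧
    (RowColumnDet.hermDet A ≠ 0 →
      ∀ y x : Fin n → Quaternion ℝ,
        Matrix.vecMul x A = y ↔
          ∀ i : Fin n,
            x i = RowColumnDet.rdet i (A.updateRow i y) / RowColumnDet.hermDet A) := by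
  rw [RowColumnDet.hermDet_eq_reDet hA]
  refine ⟨fun k => ⟨RowColumnDet.rdet_eq_reDet hA k, ?_⟩, ⟨_, rfl⟩, fun hd y x => ?_⟩
  · rw [RowColumnDet.cdet_eq_star_rdet hA, RowColumnDet.rdet_eq_reDet hA, Quaternion.star_coe]
  · refine RowColumnDet.vecMul_eq_iff_of_reDet_ne_zero hA (fun h => hd ?_) x y
    rw [h, Quaternion.coe_zero]
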